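/- Let $F_0=0$, $F_1=1$, $F_i=F_{i-1}+F_{i-2}$ be the Fibonacci numbers. Let $P$ be a polynomial with real coefficients and positive leading coefficient, and let $m$ be a natural number such that $P(m)<P(m+1)<P(m+2)<\cdots$ are positive integers and $F_i>P(i)$ for all $i\ge m$. A composition of $n$ is a finite sequence of positive integers with sum $n$. For $k\ge m$ let $t_k(n)$ be the number of compositions of $n$ all of whose parts lie in $\{P(k),P(k+1),P(k+2),\dots\}$, and let $r_k(n)$ be the number of compositions of $n$ all of whose parts lie in $\{F_k,F_{k+1},F_{k+2},\dots\}$. Let $d_k=\gcd\{P(i): i\ge k\}$ (so that $t_k(n)=0$ unless $d_k\mid n$). Then, for every $k\ge m$, $$\lim_{\substack{n\to\infty\\ d_k\mid n}}\frac{t_k(n)}{r_k(n)}=+\infty .$$ In particular, if $d_k=1$, then $$\lim_{n\to\infty}\frac{t_k(n)}{r_k(n)}=+\infty .$$ (The quotient is defined for all large $n$, because $r_k(n)>0$ for all large $n$.) -/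

import Mathlib

open Filter

/-- The set `{P(k), P(k+1), P(k+2), …} ∩ ℕ` of natural numbers attained by the real polynomial `P`
at the integers `i ≥ k`. -/
def polyParts (P : Polynomial ℝ) (k : ℕ) : Set ℕ :=
  {a | ∃ i : ℕ, k ≤ i ∧ P.eval (i : ℝ) = (a : ℝ)}

/-- The set `{F_k, F_{k+1}, F_{k+2}, …}` of Fibonacci numbers (`F_0 = 0`, `F_1 = 1`). -/
def fibParts (k : ℕ) : Set ℕ :=
  {a | ∃ i : ℕ, k ≤ i ∧ Nat.fib i = a}

/-- The number of compositions of `n` (ordered sums of positive integers) all of whose parts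
belong to `S`. -/
noncomputable def compositionCount (S : Set ℕ) (n : ℕ) : ℕ :=
  Nat.card {c : Composition n // ∀ a ∈ c.blocks, a ∈ S}

/-! Write `u i` for $F_{k+i}$ and `v i` for $P(k+i)$. The recursion on the first part compares a
composition count with a geometric sequence. With `β` in (0, 1) the root of `∑ β ^ u i = 1`,
induction gives $r_k(n) ≤ β^{-n}$. As `v i < u i`, some finite sum of the `β ^ v i` exceeds 1, and
by continuity such a sum is still at least 1 at some `x < β`; induction then gives $t_k(n) ≥ c
x^{-n}$ for large multiples `n` of $d_k$. The ratio is at least $c(β/x)^n$. Beyond integrality, the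
polynomial enters only through positivity, monotonicity and $P(i) < F_i$. -/

/-- Splitting off the first part of a composition with parts in `S`. -/
def compositionConsEquiv (S : Set ℕ) (n : ℕ) (hn : n ≠ 0) :
    {c : Composition n // ∀ a ∈ c.blocks, a ∈ S} ≃
      Σ a : {a : ℕ // (1 ≤ a ∧ a ≤ n) ∧ a ∈ S},
        {c : Composition (n - a.1) // ∀ b ∈ c.blocks, b ∈ S} where
  toFun c := match c with
    | ⟨⟨[], _, hs⟩, _⟩ => absurd hs.symm hn
    | ⟨⟨a :: l, hp, hs⟩, hc⟩ =>
      ⟨⟨a, ⟨hp (by simp), by rw [List.sum_cons] at hs; omega⟩, hc a (by simp)⟩,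
        ⟨⟨l, fun h => hp (List.mem_cons_of_mem _ h), by
          rw [List.sum_cons] at hs; dsimp only; omega⟩,
          fun b hb => hc b (List.mem_cons_of_mem _ hb)⟩⟩
  invFun p :=
    ⟨⟨p.1.1 :: p.2.1.blocks, fun {i} hi => by
        rcases List.mem_cons.1 hi with rfl | h
        · exact p.1.2.1.1
        · exact p.2.1.blocks_pos h, by
        have := p.1.2.1.2
        rw [List.sum_cons, p.2.1.blocks_sum]; omega⟩,
      fun b hb => by
        rcases List.mem_cons.1 hb with rfl | h
        · exact p.1.2.2
        · exact p.2.2 b h⟩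
  left_inv := by
    rintro ⟨⟨_ | ⟨a, l⟩, hp, hs⟩, hc⟩
    · exact absurd hs.symm hn
    · rfl
  right_inv := by
    rintro ⟨⟨a, ha⟩, ⟨⟨l, hp, hs⟩, hc⟩⟩
    rfl

open Classical in
theorem compositionCount_eq_sum (S : Set ℕ) {n : ℕ} (hn : n ≠ 0) :
    compositionCount S n =
      ∑ a ∈ (Finset.Icc 1 n).filter (· ∈ S), compositionCount S (n - a) := by
  have e : ∀ a, a ∈ (Finset.Icc 1 n).filter (· ∈ S) ↔ (1 ≤ a ∧ a ≤ n) ∧ a ∈ S := by simp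
  let _ : Fintype {a : ℕ // (1 ≤ a ∧ a ≤ n) ∧ a ∈ S} := Fintype.subtype _ e
  rw [compositionCount, Nat.card_congr (compositionConsEquiv S n hn), Nat.card_sigma]
  exact (Finset.sum_subtype _ e fun a => compositionCount S (n - a)).symm

theorem compositionCount_zero (S : Set ℕ) : compositionCount S 0 = 1 := by
  rw [compositionCount, Nat.card_eq_one_iff_unique]
  refine ⟨⟨fun a b => ?_⟩, ⟨⟨⟨[], by simp, by simp⟩, by simp⟩⟩⟩
  have hnil : ∀ c : Composition 0, c.blocks = [] := fun c =>
    List.eq_nil_iff_forall_not_mem.2 fun i hi =>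
      (c.blocks_pos hi).ne' (List.sum_eq_zero_iff.1 c.blocks_sum i hi)
  exact Subtype.ext (Composition.ext ((hnil a.1).trans (hnil b.1).symm))

/-- If `∑ x ^ a ≤ 1` over the allowed parts, the number of compositions of `n` is at most
`x ^ (-n)`. -/
theorem compositionCount_mul_pow_le_one {S : Set ℕ} {x : ℝ} (hx : 0 < x)
    (h : ∀ A : Finset ℕ, (A : Set ℕ) ⊆ S → ∑ a ∈ A, x ^ a ≤ 1) (n : ℕ) :
    (compositionCount S n : ℝ) * x ^ n ≤ 1 := by
  classical
  induction n using Nat.strong_induction_on with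
  | _ n ih =>
    rcases eq_or_ne n 0 with rfl | hn
    · simp [compositionCount_zero]
    rw [compositionCount_eq_sum S hn, Nat.cast_sum, Finset.sum_mul]
    refine (Finset.sum_le_sum fun a ha => ?_).trans
      (h ((Finset.Icc 1 n).filter (· ∈ S)) fun a ha => (Finset.mem_filter.1 ha).2)
    obtain ⟨h1, h2⟩ := Finset.mem_Icc.1 (Finset.mem_filter.1 ha).1
    have := mul_le_mul_of_nonneg_right (ih (n - a) (by omega)) (pow_nonneg hx.le a)
    rwa [mul_assoc, ← pow_add, Nat.sub_add_cancel h2, one_mul] at this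

/-- Restricting the first part to `A` drops nonnegative terms of the recursion. A finite `A` bounds
the step size in the lower-bound induction. -/
theorem sum_compositionCount_sub_le {S : Set ℕ} {A : Finset ℕ} (hA : (A : Set ℕ) ⊆ S)
    {n : ℕ} (hn : n ≠ 0) (hA0 : ∀ a ∈ A, 0 < a) (hAn : ∀ a ∈ A, a ≤ n) :
    ∑ a ∈ A, compositionCount S (n - a) ≤ compositionCount S n := by
  classical
  rw [compositionCount_eq_sum S hn]
  refine Finset.sum_le_sum_of_subset fun a ha => ?_
  simp only [Finset.mem_filter, Finset.mem_Icc]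
  exact ⟨⟨hA0 a ha, hAn a ha⟩, hA ha⟩

theorem compositionCount_pos_of_mem_closure {S : Set ℕ} (hS : ∀ a ∈ S, 0 < a) {n : ℕ}
    (hn : n ∈ AddSubmonoid.closure S) : 0 < compositionCount S n := by
  obtain ⟨l, hl, hs⟩ := AddSubmonoid.exists_list_of_mem_closure hn
  rw [compositionCount, Nat.card_pos_iff]
  exact ⟨⟨⟨⟨l, fun hi => hS _ (hl _ hi), hs⟩, hl⟩⟩, inferInstance⟩

theorem exists_forall_ge_compositionCount_pos {S : Set ℕ} (hS : ∀ a ∈ S, 0 < a) :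
    ∃ N, ∀ n ≥ N, Nat.setGcd S ∣ n → 0 < compositionCount S n := by
  obtain ⟨N, hN⟩ := Nat.exists_mem_closure_of_ge S
  exact ⟨N, fun n hn hd => compositionCount_pos_of_mem_closure hS (hN n hn hd)⟩

/-- If `∑ x ^ a ≥ 1` over finitely many allowed parts, the number of compositions of `n` is at
least a constant times `x ^ (-n)`, for all large admissible `n`. -/
theorem exists_le_compositionCount_mul_pow {S : Set ℕ} (hS : ∀ a ∈ S, 0 < a) {x : ℝ}
    (hx : 0 < x) (hx1 : x ≤ 1) {A : Finset ℕ} (hA : (A : Set ℕ) ⊆ S)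
    (hsum : 1 ≤ ∑ a ∈ A, x ^ a) :
    ∃ c > 0, ∃ N, ∀ n ≥ N, Nat.setGcd S ∣ n → c ≤ (compositionCount S n : ℝ) * x ^ n := by
  obtain ⟨N, hN⟩ := exists_forall_ge_compositionCount_pos hS
  -- For `N ≤ n < N + A.sup id + 1` positivity of the count suffices, since `x ≤ 1`. Beyond that
  -- range every `n - a` with `a ∈ A` is still at least `N`; the `+ 1` ensures `n ≠ 0`.
  have hc : 0 < x ^ (N + A.sup id + 1) := pow_pos hx _
  refine ⟨x ^ (N + A.sup id + 1), hc, N, fun n => ?_⟩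
  induction n using Nat.strong_induction_on with
  | _ n ih =>
    intro hn hd
    rcases lt_or_ge n (N + A.sup id + 1) with h | h
    · have h1 : (1 : ℝ) ≤ compositionCount S n := by exact_mod_cast hN n hn hd
      calc x ^ (N + A.sup id + 1) ≤ x ^ n := pow_le_pow_of_le_one hx.le hx1 h.le
        _ ≤ compositionCount S n * x ^ n := le_mul_of_one_le_left (pow_nonneg hx.le _) h1
    · have hsup : ∀ a ∈ A, a ≤ A.sup id := fun a ha => Finset.le_sup (f := id) ha
      have hle : ∀ a ∈ A, a ≤ n := fun a ha => by have := hsup a ha; omega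
      have hrec := sum_compositionCount_sub_le hA (n := n) (by omega)
        (fun a ha => hS a (hA ha)) hle
      calc x ^ (N + A.sup id + 1) ≤ x ^ (N + A.sup id + 1) * ∑ a ∈ A, x ^ a :=
            le_mul_of_one_le_right hc.le hsum
        _ = ∑ a ∈ A, x ^ (N + A.sup id + 1) * x ^ a := Finset.mul_sum _ _ _
        _ ≤ ∑ a ∈ A, (compositionCount S (n - a) : ℝ) * x ^ n := by
            refine Finset.sum_le_sum fun a ha => ?_
            have h0 := hS a (hA ha)
            have h1 := hsup a ha
            have := mul_le_mul_of_nonneg_right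
              (ih (n - a) (by omega) (by omega)
                (Nat.dvd_sub hd (Nat.setGcd_dvd_of_mem (hA ha)))) (pow_nonneg hx.le a)
            rwa [mul_assoc _ (x ^ (n - a)), pow_sub_mul_pow x (hle a ha)] at this
        _ = ((∑ a ∈ A, compositionCount S (n - a) : ℕ) : ℝ) * x ^ n := by
            rw [Nat.cast_sum, Finset.sum_mul]
        _ ≤ compositionCount S n * x ^ n := by
            gcongr

theorem summable_pow_of_injective {u : ℕ → ℕ} (hu : Function.Injective u) {x : ℝ} (hx : 0 ≤ x)
    (hx1 : x < 1) : Summable fun i => x ^ u i :=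
  (summable_geometric_of_lt_one hx hx1).comp_injective hu

/-- The equation `∑ x ^ (u i) = 1` has a root in `(0, 1)`. -/
theorem exists_hasSum_pow_eq_one {u : ℕ → ℕ} (hu : Function.Injective u) (hu0 : ∀ i, 0 < u i) :
    ∃ x : ℝ, 0 < x ∧ x < 1 ∧ HasSum (fun i => x ^ u i) 1 := by
  -- Two terms already tend to 2 as `r` tends to 1 from below.
  obtain ⟨r, hr0, hr1, hr⟩ : ∃ r : ℝ, 0 ≤ r ∧ r < 1 ∧ 1 < r ^ u 0 + r ^ u 1 := by
    have hcont : Continuous fun r : ℝ => r ^ u 0 + r ^ u 1 := by fun_prop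
    have h1 : ∀ᶠ r in nhdsWithin (1 : ℝ) (Set.Iio 1), 1 < r ^ u 0 + r ^ u 1 :=
      (hcont.continuousAt.eventually (lt_mem_nhds (by norm_num))).filter_mono nhdsWithin_le_nhds
    have h2 : ∀ᶠ r in nhdsWithin (1 : ℝ) (Set.Iio 1), r ∈ Set.Ioo (0 : ℝ) 1 :=
      Ioo_mem_nhdsLT one_pos
    obtain ⟨r, h, hr⟩ := (h1.and h2).exists
    exact ⟨r, hr.1.le, hr.2, h⟩
  have hcont : ContinuousOn (fun x : ℝ => ∑' i, x ^ u i) (Set.Icc 0 r) := by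
    refine continuousOn_tsum (fun i => (continuous_pow _).continuousOn)
      (summable_pow_of_injective hu hr0 hr1) fun i x hx => ?_
    rw [norm_pow, Real.norm_of_nonneg hx.1]
    exact pow_le_pow_left₀ hx.1 hx.2 _
  have hf0 : ∑' i, (0 : ℝ) ^ u i = 0 := by
    simp [fun i => (hu0 i).ne']
  have hfr : 1 ≤ ∑' i, r ^ u i := by
    have := (summable_pow_of_injective hu hr0 hr1).sum_le_tsum (Finset.range 2)
      fun i _ => pow_nonneg hr0 _
    rw [Finset.sum_range_succ, Finset.sum_range_one] at this
    exact hr.le.trans this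
  obtain ⟨x, hx, hfx⟩ := intermediate_value_Icc hr0 hcont
    (show (1 : ℝ) ∈ Set.Icc _ _ from ⟨by simp only [hf0]; norm_num, hfr⟩)
  have hfx : ∑' i, x ^ u i = 1 := hfx
  have hx0 : x ≠ 0 := by
    rintro rfl
    rw [hf0] at hfx
    exact zero_ne_one hfx
  have hx1 := hx.2.trans_lt hr1
  refine ⟨x, lt_of_le_of_ne hx.1 hx0.symm, hx1, ?_⟩
  rw [← hfx]
  exact (summable_pow_of_injective hu hx.1 hx1).hasSum

/-- If `v i < u i` for all `i` and `∑ β ^ (u i) = 1`, a finite partial sum of `∑ x ^ (v i)`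
already exceeds `1` at some `x < β`. -/
theorem exists_lt_one_le_sum_pow {u v : ℕ → ℕ} (huv : ∀ i, v i < u i) {β : ℝ} (hβ : 0 < β)
    (hβ1 : β < 1) (hsum : HasSum (fun i => β ^ u i) 1) :
    ∃ x, 0 < x ∧ x < β ∧ ∃ N, 1 ≤ ∑ i ∈ Finset.range N, x ^ v i := by
  have hlt : ∀ i, β ^ u i < β ^ v i := fun i => pow_lt_pow_right_of_lt_one₀ hβ hβ1 (huv i)
  -- The gain at index 0 alone outweighs the tail cut off from the series.
  have hev := hsum.tendsto_sum_nat.eventually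
    (lt_mem_nhds (show 1 - (β ^ v 0 - β ^ u 0) < 1 by linarith [hlt 0]))
  obtain ⟨N, hN, hN0⟩ := (hev.and (eventually_gt_atTop 0)).exists
  have h0 : (0 : ℕ) ∈ Finset.range N := Finset.mem_range.2 hN0
  have hgap : β ^ v 0 - β ^ u 0 ≤ ∑ i ∈ Finset.range N, (β ^ v i - β ^ u i) :=
    Finset.single_le_sum (f := fun i => β ^ v i - β ^ u i)
      (fun i _ => sub_nonneg.2 (hlt i).le) h0
  rw [Finset.sum_sub_distrib] at hgap
  have hβN : 1 < ∑ i ∈ Finset.range N, β ^ v i := by linarith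
  have hcont : Continuous fun x : ℝ => ∑ i ∈ Finset.range N, x ^ v i := by fun_prop
  have h1 : ∀ᶠ x in nhdsWithin β (Set.Iio β), 1 < ∑ i ∈ Finset.range N, x ^ v i :=
    (hcont.continuousAt.eventually (lt_mem_nhds hβN)).filter_mono nhdsWithin_le_nhds
  have h2 : ∀ᶠ x in nhdsWithin β (Set.Iio β), x ∈ Set.Ioo 0 β := Ioo_mem_nhdsLT hβ
  obtain ⟨x, h, hx⟩ := (h1.and h2).exists
  exact ⟨x, hx.1, hx.2, N, h.le⟩

/-- Termwise smaller parts give asymptotically far more compositions. -/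
theorem tendsto_compositionCount_div_atTop {u v : ℕ → ℕ} (hu : Function.Injective u)
    (hv : Function.Injective v) (hv0 : ∀ i, 0 < v i) (huv : ∀ i, v i < u i)
    (hgcd : Nat.setGcd (Set.range u) = 1) :
    Tendsto
      (fun n : ℕ =>
        (compositionCount (Set.range v) (Nat.setGcd (Set.range v) * n) : ℝ) /
          (compositionCount (Set.range u) (Nat.setGcd (Set.range v) * n) : ℝ))
      atTop atTop := by
  classical
  have hu0 : ∀ i, 0 < u i := fun i => (hv0 i).trans (huv i)
  obtain ⟨β, hβ, hβ1, hsum⟩ := exists_hasSum_pow_eq_one hu hu0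
  obtain ⟨x, hx, hxβ, M, hM⟩ := exists_lt_one_le_sum_pow huv hβ hβ1 hsum
  have hupper := compositionCount_mul_pow_le_one (S := Set.range u) hβ fun A hA => by
    obtain ⟨B, rfl⟩ : ∃ B : Finset ℕ, B.image u = A := by
      obtain ⟨B, -, hB⟩ := Finset.subset_set_image_iff.1
        (show (A : Set ℕ) ⊆ u '' Set.univ by rwa [Set.image_univ])
      exact ⟨B, hB⟩
    rw [Finset.sum_image fun i _ j _ h => hu h]
    exact sum_le_hasSum B (fun i _ => pow_nonneg hβ.le _) hsum
  obtain ⟨c, hc, N, hlower⟩ := exists_le_compositionCount_mul_pow (S := Set.range v)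
    (by rintro _ ⟨i, rfl⟩; exact hv0 i) hx (hxβ.trans hβ1).le
    (A := (Finset.range M).image v) (by
      rw [Finset.coe_image]
      exact Set.image_subset_range _ _)
    (by rwa [Finset.sum_image fun i _ j _ h => hv h])
  obtain ⟨N', hpos⟩ := exists_forall_ge_compositionCount_pos (S := Set.range u)
    (by rintro _ ⟨i, rfl⟩; exact hu0 i)
  have hd : 0 < Nat.setGcd (Set.range v) :=
    Nat.pos_of_dvd_of_pos (Nat.setGcd_dvd_of_mem ⟨0, rfl⟩) (hv0 0)
  have hmul : Tendsto (fun n => Nat.setGcd (Set.range v) * n) atTop atTop :=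
    tendsto_id.const_mul_atTop' hd
  have hgeom : Tendsto (fun n : ℕ => c * (β / x) ^ (Nat.setGcd (Set.range v) * n)) atTop atTop :=
    ((tendsto_pow_atTop_atTop_of_one_lt ((one_lt_div hx).2 hxβ)).comp hmul).const_mul_atTop hc
  refine tendsto_atTop_mono' _ ?_ hgeom
  filter_upwards [hmul.eventually_ge_atTop (max N N')] with n hn
  have ht := hlower _ ((le_max_left _ _).trans hn) (dvd_mul_right _ n)
  have hr := hupper (Nat.setGcd (Set.range v) * n)
  have hr0 : (0 : ℝ) < compositionCount (Set.range u) (Nat.setGcd (Set.range v) * n) := by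
    exact_mod_cast hpos _ ((le_max_right _ _).trans hn) (hgcd ▸ one_dvd _)
  generalize Nat.setGcd (Set.range v) * n = q at *
  rw [le_div_iff₀ hr0, div_pow]
  have hxq := pow_pos hx q
  calc c * (β ^ q / x ^ q) * compositionCount (Set.range u) q
      = c / x ^ q * (compositionCount (Set.range u) q * β ^ q) := by ring
    _ ≤ c / x ^ q := mul_le_of_le_one_right (div_pos hc hxq).le hr
    _ ≤ compositionCount (Set.range v) q := (div_le_iff₀ hxq).2 ht

theorem fibParts_eq_range (k : ℕ) : fibParts k = Set.range fun i => Nat.fib (k + i) := by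
  ext a
  constructor
  · rintro ⟨i, hi, rfl⟩
    exact ⟨i - k, congrArg Nat.fib (Nat.add_sub_cancel' hi)⟩
  · rintro ⟨i, rfl⟩
    exact ⟨k + i, Nat.le_add_right _ _, rfl⟩

theorem polyParts_eq_range {P : Polynomial ℝ} {k : ℕ} {v : ℕ → ℕ}
    (hv : ∀ i, P.eval ((k + i : ℕ) : ℝ) = v i) : polyParts P k = Set.range v := by
  ext a
  constructor
  · rintro ⟨i, hi, h⟩
    refine ⟨i - k, ?_⟩
    have := hv (i - k)
    rw [Nat.add_sub_cancel' hi, h] at this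
    exact_mod_cast this.symm
  · rintro ⟨i, rfl⟩
    exact ⟨k + i, Nat.le_add_right _ _, hv i⟩

theorem setGcd_fibParts (k : ℕ) : Nat.setGcd (fibParts k) = 1 :=
  Nat.eq_one_of_dvd_coprimes (Nat.fib_coprime_fib_succ k)
    (Nat.setGcd_dvd_of_mem ⟨k, le_rfl, rfl⟩) (Nat.setGcd_dvd_of_mem ⟨k + 1, k.le_succ, rfl⟩)

theorem theorem4p3 (P : Polynomial ℝ) (hlead : 0 < P.leadingCoeff) (m : ℕ)
    (hint : ∀ i : ℕ, m ≤ i → ∃ a : ℕ, 0 < a ∧ P.eval (i : ℝ) = (a : ℝ))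
    (hmono : ∀ i j : ℕ, m ≤ i → i < j → P.eval (i : ℝ) < P.eval (j : ℝ))
    (hfib : ∀ i : ℕ, m ≤ i → P.eval (i : ℝ) < (Nat.fib i : ℝ))
    (k : ℕ) (hk : m ≤ k) :
    Tendsto
        (fun n : ℕ =>
          (compositionCount (polyParts P k) (Nat.setGcd (polyParts P k) * n) : ℝ) /
            (compositionCount (fibParts k) (Nat.setGcd (polyParts P k) * n) : ℝ))
        atTop atTop ∧
      (Nat.setGcd (polyParts P k) = 1 →
        Tendsto
          (fun n : ℕ =>
            (compositionCount (polyParts P k) n : ℝ) / (compositionCount (fibParts k) n : ℝ))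
          atTop atTop) := by
  have hkm : ∀ i, m ≤ k + i := fun i => hk.trans (Nat.le_add_right _ _)
  choose v hv0 hv using fun i => hint (k + i) (hkm i)
  have huv : ∀ i, v i < Nat.fib (k + i) := fun i => by
    have := hfib (k + i) (hkm i)
    rw [hv i] at this
    exact_mod_cast this
  have hvinj : Function.Injective v := by
    refine StrictMono.injective fun i j hij => ?_
    have := hmono (k + i) (k + j) (hkm i) (by omega)
    rw [hv i, hv j] at this
    exact_mod_cast this
  -- Injectivity needs this because $F_1 = F_2$; it follows from $1 ≤ P(k) < F_k$.
  have hk2 : 2 ≤ k := by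
    have h1 := (Nat.succ_le_of_lt (hv0 0)).trans_lt (huv 0)
    by_contra hlt
    have h2 : Nat.fib (k + 0) ≤ Nat.fib 2 := Nat.fib_mono (by omega)
    rw [Nat.fib_two] at h2
    omega
  have huinj : Function.Injective fun i => Nat.fib (k + i) :=
    StrictMono.injective fun i j hij => (Nat.fib_lt_fib (by omega)).2 (by omega)
  have hgcd := setGcd_fibParts k
  rw [fibParts_eq_range] at hgcd
  have key := tendsto_compositionCount_div_atTop huinj hvinj hv0 huv hgcd
  rw [← fibParts_eq_range, ← polyParts_eq_range hv] at key
  refine ⟨key, fun hd => ?_⟩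
  simpa only [hd, one_mul] using key
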